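/- Let $d\in\mathbb N$ and let $\mathcal K_2:\mathbb R\to\mathbb R$ be a continuous kernel whose Fourier transform $\psi_{\mathcal K_2}(t)=\int e^{-itx}\mathcal K_2(x)\,dx$ (understood in the sense of tempered distributions) is an integrable function that is positive almost everywhere. Fix a bandwidth $h>0$ and known scale factors $\sigma_1,\dots,\sigma_d>0$, and put $\mathcal K_{2,h}(x)=\mathcal K_2(x/h)/h$. Let $\mathbf Y=(Y_1,\dots,Y_d)$ be a random vector in $\mathbb R^d$ with an arbitrary distribution (no density or moment assumption), and let $\mathbf Y(n)=(Y_1(n),\dots,Y_d(n))$, $n\ge 1$, be independent random vectors with the same distribution as $\mathbf Y$. For $N\ge1$ define $$\widehat Q_N=\frac12\Big\{\frac1N\sum_{m=1}^N\widehat\pi_{\mathbf Y}(\mathbf Y(m))+\prod_{k=1}^d\Big(\frac1N\sum_{m=1}^N\widehat\pi_{Y_k}(Y_k(m))\Big)-\frac2N\sum_{m=1}^N\prod_{k=1}^d\widehat\pi_{Y_k}(Y_k(m))\Big\},$$ where $$\widehat\pi_{\mathbf Y}(\mathbf y)=\frac1N\sum_{n=1}^N\prod_{i=1}^d\mathcal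 K_{2,h}\Big(\frac{y_i-Y_i(n)}{\sigma_i}\Big),\qquad \widehat\pi_{Y_k}(y)=\frac1N\sum_{n=1}^N\mathcal K_{2,h}\Big(\frac{y-Y_k(n)}{\sigma_k}\Big).$$ If $Y_1,\dots,Y_d$ are not mutually independent, then almost surely $\widehat Q_N$ converges as $N\to\infty$ and $\lim_{N\to\infty}\widehat Q_N>0$. -/

import Mathlib

open MeasureTheory ProbabilityTheory Filter Topology
open scoped SchwartzMap

/-- `IsFourierTransform f ψ`: the function `ψ` is the Fourier transform
`ψ(t) = ∫ e^{-itx} f(x) dx` of `f`, in the sense of tempered distributions, i.e. tested against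
Schwartz functions. For integrable `f` this is the usual integral, for square integrable `f` the
Plancherel transform (both up to null sets). -/
def IsFourierTransform (f ψ : ℝ → ℝ) : Prop :=
  ∀ φ : 𝓢(ℝ, ℂ),
    Integrable (fun x : ℝ =>
      (f x : ℂ) * ∫ t : ℝ, Complex.exp (-(Complex.I * (t : ℂ) * (x : ℂ))) * φ t) ∧
    Integrable (fun t : ℝ => (ψ t : ℂ) * φ t) ∧
    (∫ x : ℝ, (f x : ℂ) * ∫ t : ℝ, Complex.exp (-(Complex.I * (t : ℂ) * (x : ℂ))) * φ t)
      = ∫ t : ℝ, (ψ t : ℂ) * φ t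

/-- The rescaled kernel `K_{2,h}(x) = K₂(x / h) / h`. -/
noncomputable def scaledKernel (K₂ : ℝ → ℝ) (h x : ℝ) : ℝ := K₂ (x / h) / h

/-- Sample average of `g` over the first `N` observations `y 0, …, y (N - 1)`. -/
noncomputable def sampleMean {d : ℕ} (y : ℕ → Fin d → ℝ) (N : ℕ) (g : (Fin d → ℝ) → ℝ) : ℝ :=
  (∑ n ∈ Finset.range N, g (y n)) / N

/-- The joint estimated function `π̂_Y(z)`. -/
noncomputable def piHatJoint {d : ℕ} (K₂ : ℝ → ℝ) (h : ℝ) (σ : Fin d → ℝ)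
    (y : ℕ → Fin d → ℝ) (N : ℕ) (z : Fin d → ℝ) : ℝ :=
  sampleMean y N fun w => ∏ i, scaledKernel K₂ h ((z i - w i) / σ i)

/-- The marginal estimated function `π̂_{Y_k}(z)`. -/
noncomputable def piHatMarginal {d : ℕ} (K₂ : ℝ → ℝ) (h : ℝ) (σ : Fin d → ℝ)
    (y : ℕ → Fin d → ℝ) (N : ℕ) (k : Fin d) (z : ℝ) : ℝ :=
  sampleMean y N fun w => scaledKernel K₂ h ((z - w k) / σ k)

/-- The estimator `Q̂` of the quadratic dependence from the first `N` observations. -/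
noncomputable def QHat {d : ℕ} (K₂ : ℝ → ℝ) (h : ℝ) (σ : Fin d → ℝ)
    (y : ℕ → Fin d → ℝ) (N : ℕ) : ℝ :=
  (1 / 2) *
    (sampleMean y N (fun z => piHatJoint K₂ h σ y N z)
      + ∏ k, sampleMean y N (fun z => piHatMarginal K₂ h σ y N k (z k))
      - 2 * sampleMean y N (fun z => ∏ k, piHatMarginal K₂ h σ y N k (z k)))

/-! By Fourier inversion each rescaled kernel is the characteristic function of a finite measure `ν
k` with an almost everywhere positive density. Expanding the squared modulus then makes Q̂ half the
squared L²(`Measure.pi ν`) norm of the joint empirical characteristic function minus the product of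
its marginals (`QHat_eq_integral`).

For each frequency the strong law gives an almost sure limit of this difference, namely
`charFunDefect`. Fubini for null sets supplies one almost sure event on which convergence holds at
almost every frequency, and dominated convergence passes to the integral. The defect is continuous
and, under dependence, nonzero somewhere. Since `Measure.pi ν` charges every nonempty open set, the
limit is positive. -/

section Fourier

open scoped FourierTransform ComplexConjugate

/-! ### Fourier inversion and the spectral measure of the kernel -/

/-- The plane wave `e^{itx}`. -/
noncomputable def planeWave (t x : ℝ) : ℂ := Complex.exp (((t * x : ℝ) : ℂ) * Complex.I)

@[simp] lemma norm_planeWave (t x : ℝ) : ‖planeWave t x‖ = 1 :=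
  Complex.norm_exp_ofReal_mul_I _

@[fun_prop] lemma Continuous.planeWave {X : Type*} [TopologicalSpace X] {f g : X → ℝ}
    (hf : Continuous f) (hg : Continuous g) : Continuous fun x => planeWave (f x) (g x) := by
  unfold _root_.planeWave
  fun_prop

@[fun_prop] lemma Measurable.planeWave {X : Type*} [MeasurableSpace X] {f g : X → ℝ}
    (hf : Measurable f) (hg : Measurable g) : Measurable fun x => planeWave (f x) (g x) := by
  unfold _root_.planeWave
  fun_prop

lemma planeWave_sub (t x y : ℝ) : planeWave t (x - y) = planeWave t x * conj (planeWave t y) := by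
  simp only [planeWave, ← Complex.exp_conj, map_mul, Complex.conj_ofReal, Complex.conj_I,
    ← Complex.exp_add]
  congr 1
  push_cast
  ring

/-- Every Schwartz function is the Fourier transform of a Schwartz function given by the inversion
integral. -/
lemma exists_schwartz_fourier_eq (g : 𝓢(ℝ, ℂ)) : ∃ φ : 𝓢(ℝ, ℂ),
    (∀ x : ℝ, ∫ t : ℝ, Complex.exp (-(Complex.I * (t : ℂ) * (x : ℂ))) * φ t = g x) ∧
    ∀ t : ℝ, φ t = ((2 * Real.pi)⁻¹ : ℝ) * ∫ x : ℝ, planeWave t x * g x := by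
  have hpi : 2 * Real.pi ≠ 0 := by positivity
  -- Dilating by 2π converts between the kernels `e^{-itx}` and `e^{-2πitx}`.
  let L : ℝ ≃L[ℝ] ℝ := ContinuousLinearEquiv.unitsEquivAut ℝ (Units.mk0 (2 * Real.pi) hpi)
  let gd : 𝓢(ℝ, ℂ) := SchwartzMap.compCLMOfContinuousLinearEquiv ℂ L g
  have hgd : ∀ y, gd y = g (2 * Real.pi * y) := fun y => by
    simp [gd, L, mul_comm]
  refine ⟨𝓕⁻ gd, fun x => ?_, fun t => ?_⟩
  · have h1 : (𝓕 (𝓕⁻ gd) : 𝓢(ℝ, ℂ)) (x / (2 * Real.pi)) = g x := by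
      rw [FourierTransform.fourier_fourierInv_eq, hgd]
      congr 1
      field_simp
    rw [← h1, SchwartzMap.fourier_coe, Real.fourier_real_eq_integral_exp_smul]
    refine integral_congr_ae (ae_of_all _ fun s => ?_)
    simp only [smul_eq_mul]
    congr 2
    push_cast
    field_simp
  · rw [SchwartzMap.fourierInv_coe, Real.fourierInv_eq']
    have := Measure.integral_comp_mul_left (fun x : ℝ => planeWave t x * g x) (2 * Real.pi)
    rw [abs_of_pos (by positivity), Complex.real_smul] at this
    rw [← this]
    refine integral_congr_ae (ae_of_all _ fun s => ?_)
    simp only [smul_eq_mul, hgd, planeWave]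
    congr 2
    simp only [RCLike.inner_apply, conj_trivial]
    push_cast
    ring

lemma continuous_integral_planeWave_mul {ψ : ℝ → ℝ} (hψ : Integrable ψ) :
    Continuous fun x : ℝ => ∫ t : ℝ, planeWave t x * (ψ t : ℂ) := by
  refine continuous_of_dominated (bound := fun t => ‖ψ t‖) (fun x => ?_)
    (fun x => ae_of_all _ fun t => ?_) hψ.norm (ae_of_all _ fun t => by fun_prop)
  · exact (by fun_prop : Continuous fun t => planeWave t x).aestronglyMeasurable.mul
      hψ.ofReal.aestronglyMeasurable
  · simp

/-- Fourier inversion for a continuous function whose distributional Fourier transform is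
integrable. -/
lemma IsFourierTransform.eq_integral {K ψ : ℝ → ℝ} (hK : Continuous K)
    (hψ : IsFourierTransform K ψ) (hψ_int : Integrable ψ) (x : ℝ) :
    (K x : ℂ) = ((2 * Real.pi)⁻¹ : ℝ) * ∫ t : ℝ, planeWave t x * (ψ t : ℂ) := by
  set G : ℝ → ℂ := fun x => ((2 * Real.pi)⁻¹ : ℝ) * ∫ t : ℝ, planeWave t x * (ψ t : ℂ) with hG
  have hGc : Continuous G := continuous_const.mul (continuous_integral_planeWave_mul hψ_int)
  have hKc : Continuous fun x => (K x : ℂ) := by fun_prop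
  have hdiff : Continuous fun x => (K x : ℂ) - G x := hKc.sub hGc
  suffices h0 : ∀ᵐ x : ℝ, (K x : ℂ) - G x = 0 by
    have := (hdiff.ae_eq_iff_eq (volume : Measure ℝ) continuous_const).1 h0
    exact sub_eq_zero.1 (congrFun this x)
  refine ae_eq_zero_of_integral_contDiff_smul_eq_zero hdiff.locallyIntegrable
    fun g hg hgc => ?_
  have hgc' : HasCompactSupport fun x => (g x : ℂ) := hgc.comp_left (g := Complex.ofReal) rfl
  let gs : 𝓢(ℝ, ℂ) := hgc'.toSchwartzMap (Complex.ofRealCLM.contDiff.comp hg)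
  have hgs : ∀ x, gs x = (g x : ℂ) := fun x => rfl
  -- With φ the inverse transform of g, the hypothesis reads ∫ K g = ∫ ψ φ, and Fubini turns the
  -- right side into ∫ g G.
  obtain ⟨φ, hφ1, hφ2⟩ := exists_schwartz_fourier_eq gs
  obtain ⟨-, -, h3⟩ := hψ φ
  simp only [hφ1] at h3
  simp only [hφ2, hgs] at h3
  have hgi : Integrable fun x => (g x : ℂ) :=
    (Complex.continuous_ofReal.comp hg.continuous).integrable_of_hasCompactSupport hgc'
  have hprod : Integrable (fun p : ℝ × ℝ => planeWave p.1 p.2 * ((ψ p.1 : ℂ) * (g p.2 : ℂ)))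
      (volume.prod volume) := by
    refine (hψ_int.ofReal.mul_prod hgi).bdd_mul (c := 1)
      (by fun_prop : Continuous fun p : ℝ × ℝ => planeWave p.1 p.2).aestronglyMeasurable
      (ae_of_all _ fun p => by simp)
  have hswap : ∫ t : ℝ, (ψ t : ℂ) * (((2 * Real.pi)⁻¹ : ℝ) * ∫ x : ℝ, planeWave t x * (g x : ℂ))
      = ∫ x : ℝ, (g x : ℂ) * G x := by
    have := integral_integral_swap
      (f := fun t x => planeWave t x * ((ψ t : ℂ) * (g x : ℂ))) hprod
    calc _ = ∫ t : ℝ, ((2 * Real.pi)⁻¹ : ℝ) *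
          ∫ x : ℝ, planeWave t x * ((ψ t : ℂ) * (g x : ℂ)) := by
          refine integral_congr_ae (ae_of_all _ fun t => ?_)
          simp only [← integral_const_mul]
          refine integral_congr_ae (ae_of_all _ fun s => ?_)
          simp only; ring
      _ = ∫ x : ℝ, ((2 * Real.pi)⁻¹ : ℝ) *
          ∫ t : ℝ, planeWave t x * ((ψ t : ℂ) * (g x : ℂ)) := by
          rw [integral_const_mul, this, integral_const_mul]
      _ = _ := by
          refine integral_congr_ae (ae_of_all _ fun t => ?_)
          simp only [hG, ← integral_const_mul]
          refine integral_congr_ae (ae_of_all _ fun s => ?_)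
          simp only; ring
  rw [hswap] at h3
  have hi1 : Integrable fun x => (g x : ℂ) * (K x : ℂ) :=
    ((Complex.continuous_ofReal.comp hg.continuous).mul hKc).integrable_of_hasCompactSupport
      hgc'.mul_right
  have hi2 : Integrable fun x => (g x : ℂ) * G x :=
    ((Complex.continuous_ofReal.comp hg.continuous).mul hGc).integrable_of_hasCompactSupport
      hgc'.mul_right
  simp only [Complex.real_smul, mul_sub]
  rw [integral_sub hi1 hi2, ← h3, sub_eq_zero]
  simp only [mul_comm]

/-- A rescaled kernel is the characteristic function of a finite measure charging all nonempty open
sets. -/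
lemma IsFourierTransform.exists_measure_scaledKernel {K ψ : ℝ → ℝ} (hK : Continuous K)
    (hψ : IsFourierTransform K ψ) (hψ_int : Integrable ψ) (hψ_pos : ∀ᵐ t : ℝ, 0 < ψ t)
    {h s : ℝ} (hh : 0 < h) (hs : 0 < s) :
    ∃ ν : Measure ℝ, IsFiniteMeasure ν ∧ ν.IsOpenPosMeasure ∧
      ∀ x, (scaledKernel K h (x / s) : ℂ) = ∫ t, planeWave t x ∂ν := by
  have ha : s * h ≠ 0 := by positivity
  -- The substitution u = s h t has Jacobian s h; together with the 1/(2π) of inversion and the 1/h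
  -- of the rescaling this leaves s/(2π).
  set c : ℝ := s / (2 * Real.pi) with hc
  have hcpos : 0 < c := by positivity
  let f : ℝ → ℝ := fun t => c * ψ ((s * h) * t)
  have hf : Integrable f := (hψ_int.comp_mul_left' ha).const_mul c
  have hqmp : Measure.QuasiMeasurePreserving (fun t : ℝ => (s * h) * t) :=
    ⟨by fun_prop, by
      rw [Real.map_volume_mul_left ha]
      exact Measure.smul_absolutelyContinuous⟩
  have hfpos : ∀ᵐ t : ℝ, 0 < f t := by
    filter_upwards [hqmp.ae hψ_pos] with t ht
    exact mul_pos hcpos ht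
  refine ⟨volume.withDensity fun t => ENNReal.ofReal (f t), ?_, ?_, fun x => ?_⟩
  · exact isFiniteMeasure_withDensity_ofReal hf.2
  -- As the density vanishes almost nowhere, Lebesgue measure is absolutely continuous with respect
  -- to the new measure.
  · refine (withDensity_absolutelyContinuous' hf.aemeasurable.ennreal_ofReal ?_).isOpenPosMeasure
    filter_upwards [hfpos] with t ht
    simpa using ht
  · rw [integral_withDensity_eq_integral_toReal_smul₀ hf.aemeasurable.ennreal_ofReal (by simp)]
    have h1 : ∫ t, (ENNReal.ofReal (f t)).toReal • planeWave t x =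
        ∫ t, (fun u => (c : ℂ) * (planeWave u (x / s / h) * (ψ u : ℂ))) ((s * h) * t) := by
      refine integral_congr_ae ?_
      filter_upwards [hfpos] with t ht
      rw [ENNReal.toReal_ofReal ht.le, Complex.real_smul]
      simp only [f, planeWave]
      rw [show s * h * t * (x / s / h) = t * x by field_simp]
      push_cast
      ring
    have h2 := Measure.integral_comp_mul_left
      (fun u => (c : ℂ) * (planeWave u (x / s / h) * (ψ u : ℂ))) (s * h)
    rw [h1, h2, integral_const_mul, scaledKernel, Complex.ofReal_div,
      hψ.eq_integral hK hψ_int, abs_of_pos (by positivity), Complex.real_smul, hc]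
    have hsC : (s : ℂ) ≠ 0 := by exact_mod_cast hs.ne'
    push_cast
    field_simp

end Fourier

/-! ### The estimator as an L² distance -/

/-- The empirical characteristic function of the first `N` observations. -/
noncomputable def empiricalCharFun {d : ℕ} (y : ℕ → Fin d → ℝ) (N : ℕ) (t : Fin d → ℝ) : ℂ :=
  (∑ n ∈ Finset.range N, ∏ i, planeWave (t i) (y n i)) / N

/-- The product of the marginal empirical characteristic functions. -/
noncomputable def empiricalCharFunProd {d : ℕ} (y : ℕ → Fin d → ℝ) (N : ℕ) (t : Fin d → ℝ) : ℂ :=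
  ∏ k, (∑ n ∈ Finset.range N, planeWave (t k) (y n k)) / N

lemma norm_sum_range_div_le_one {N : ℕ} {f : ℕ → ℂ} (hf : ∀ n, ‖f n‖ ≤ 1) :
    ‖(∑ n ∈ Finset.range N, f n) / (N : ℂ)‖ ≤ 1 := by
  rw [norm_div, Complex.norm_natCast]
  -- Nonnegativity of N suffices: for N = 0 the quotient is 0.
  refine div_le_one_of_le₀ ?_ (Nat.cast_nonneg N)
  simpa using norm_sum_le_of_le (Finset.range N) fun n _ => hf n

lemma norm_prod_le_one {ι : Type*} [Fintype ι] {f : ι → ℂ} (hf : ∀ i, ‖f i‖ ≤ 1) :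
    ‖∏ i, f i‖ ≤ 1 := by
  rw [norm_prod]
  exact Finset.prod_le_one (fun i _ => norm_nonneg _) fun i _ => hf i

section Empirical

open scoped ComplexConjugate

variable {d : ℕ} (y : ℕ → Fin d → ℝ) (N : ℕ)

lemma continuous_empiricalCharFun : Continuous (empiricalCharFun y N) := by
  unfold empiricalCharFun
  fun_prop

lemma continuous_empiricalCharFunProd : Continuous (empiricalCharFunProd y N) := by
  unfold empiricalCharFunProd
  fun_prop

lemma norm_empiricalCharFun_le (t : Fin d → ℝ) : ‖empiricalCharFun y N t‖ ≤ 1 :=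
  norm_sum_range_div_le_one fun n => norm_prod_le_one fun i => by simp

lemma norm_empiricalCharFunProd_le (t : Fin d → ℝ) : ‖empiricalCharFunProd y N t‖ ≤ 1 :=
  norm_prod_le_one fun i => norm_sum_range_div_le_one fun n => by simp

lemma empiricalCharFun_mul_conj_self (t : Fin d → ℝ) :
    empiricalCharFun y N t * conj (empiricalCharFun y N t) =
      (∑ m ∈ Finset.range N, (∑ n ∈ Finset.range N,
        ∏ i, planeWave (t i) (y m i - y n i)) / N) / N := by
  simp only [empiricalCharFun, planeWave_sub, Finset.prod_mul_distrib, map_div₀, map_sum, map_prod,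
    Complex.conj_natCast, ← Finset.mul_sum, mul_div_assoc, ← Finset.sum_mul]
  ring

lemma empiricalCharFunProd_mul_conj_self (t : Fin d → ℝ) :
    empiricalCharFunProd y N t * conj (empiricalCharFunProd y N t) =
      ∏ k, (∑ m ∈ Finset.range N, (∑ n ∈ Finset.range N,
        planeWave (t k) (y m k - y n k)) / N) / N := by
  simp only [empiricalCharFunProd, planeWave_sub, map_div₀, map_sum, map_prod,
    Complex.conj_natCast, ← Finset.mul_sum, mul_div_assoc, ← Finset.sum_mul,
    ← Finset.prod_mul_distrib]
  exact Finset.prod_congr rfl fun k _ => by ring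

/-- The joint factor contributes a single index m shared by all coordinates, while each marginal
factor keeps its own sum over n; this is the shape of the cross term of Q̂. -/
lemma empiricalCharFun_mul_conj_empiricalCharFunProd (t : Fin d → ℝ) :
    empiricalCharFun y N t * conj (empiricalCharFunProd y N t) =
      (∑ m ∈ Finset.range N, ∏ k, (∑ n ∈ Finset.range N,
        planeWave (t k) (y m k - y n k)) / N) / N := by
  simp only [empiricalCharFun, empiricalCharFunProd, planeWave_sub, map_div₀, map_sum, map_prod,
    Complex.conj_natCast, ← Finset.mul_sum, mul_div_assoc, ← Finset.sum_mul,
    Finset.prod_mul_distrib]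
  ring

variable {K₂ : ℝ → ℝ} {h : ℝ} {σ : Fin d → ℝ} {ν : Fin d → Measure ℝ}
  [∀ k, IsFiniteMeasure (ν k)]

lemma integrable_planeWave (ν : Measure ℝ) [IsFiniteMeasure ν] (x : ℝ) :
    Integrable (fun t => planeWave t x) ν :=
  Integrable.of_bound (by fun_prop : Continuous fun t => planeWave t x).aestronglyMeasurable 1
    (ae_of_all _ fun t => by simp)

lemma integrable_sum_planeWave (ν : Measure ℝ) [IsFiniteMeasure ν] (x : ℕ → ℝ) :
    Integrable (fun t => (∑ n ∈ Finset.range N, planeWave t (x n)) / N) ν :=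
  (integrable_finsetSum _ fun n _ => integrable_planeWave ν (x n)).div_const _

variable (hν : ∀ k x, (scaledKernel K₂ h (x / σ k) : ℂ) = ∫ t, planeWave t x ∂ν k)

include hν in
lemma piHatMarginal_eq_integral (k : Fin d) (z : ℝ) :
    (piHatMarginal K₂ h σ y N k z : ℂ) =
      ∫ t, (∑ n ∈ Finset.range N, planeWave t (z - y n k)) / N ∂ν k := by
  rw [integral_div, integral_finsetSum _ fun n _ => integrable_planeWave _ _]
  simp [piHatMarginal, sampleMean, hν]

include hν in
lemma integral_empiricalCharFun_mul_conj_self :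
    ∫ t, empiricalCharFun y N t * conj (empiricalCharFun y N t) ∂Measure.pi ν =
      (sampleMean y N (fun z => piHatJoint K₂ h σ y N z) : ℂ) := by
  have hi : ∀ m n, Integrable (fun t : Fin d → ℝ => ∏ i, planeWave (t i) (y m i - y n i))
      (Measure.pi ν) := fun m n =>
    Integrable.fintype_prod fun i => integrable_planeWave (ν i) (y m i - y n i)
  simp only [empiricalCharFun_mul_conj_self]
  rw [integral_div, integral_finsetSum _ fun m _ =>
    (integrable_finsetSum _ fun n _ => hi m n).div_const _]
  simp only [sampleMean, piHatJoint, Complex.ofReal_div, Complex.ofReal_sum, Complex.ofReal_prod,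
    Complex.ofReal_natCast, hν]
  congr 1
  refine Finset.sum_congr rfl fun m _ => ?_
  rw [integral_div, integral_finsetSum _ fun n _ => hi m n]
  congr 1
  exact Finset.sum_congr rfl fun n _ =>
    integral_fintype_prod_eq_prod fun i s => planeWave s (y m i - y n i)

include hν in
lemma integral_empiricalCharFunProd_mul_conj_self :
    ∫ t, empiricalCharFunProd y N t * conj (empiricalCharFunProd y N t) ∂Measure.pi ν =
      (∏ k, sampleMean y N (fun z => piHatMarginal K₂ h σ y N k (z k)) : ℝ) := by
  simp only [empiricalCharFunProd_mul_conj_self]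
  rw [integral_fintype_prod_eq_prod fun k s => (∑ m ∈ Finset.range N, (∑ n ∈ Finset.range N,
        planeWave s (y m k - y n k)) / (N : ℂ)) / (N : ℂ), Complex.ofReal_prod]
  refine Finset.prod_congr rfl fun k _ => ?_
  rw [integral_div, integral_finsetSum _ fun m _ => integrable_sum_planeWave N (ν k) _]
  simp [sampleMean, piHatMarginal_eq_integral y N hν]

include hν in
lemma integral_empiricalCharFun_mul_conj_empiricalCharFunProd :
    ∫ t, empiricalCharFun y N t * conj (empiricalCharFunProd y N t) ∂Measure.pi ν =
      (sampleMean y N (fun z => ∏ k, piHatMarginal K₂ h σ y N k (z k)) : ℂ) := by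
  simp only [empiricalCharFun_mul_conj_empiricalCharFunProd]
  rw [integral_div, integral_finsetSum _ fun m _ =>
    Integrable.fintype_prod fun k => integrable_sum_planeWave N (ν k) fun n => y m k - y n k]
  simp only [sampleMean, Complex.ofReal_div, Complex.ofReal_sum, Complex.ofReal_prod,
    Complex.ofReal_natCast, piHatMarginal_eq_integral y N hν]
  congr 1
  exact Finset.sum_congr rfl fun m _ => integral_fintype_prod_eq_prod fun k s =>
    (∑ n ∈ Finset.range N, planeWave s (y m k - y n k)) / (N : ℂ)

include hν in
/-- The estimator is a weighted `L²` distance between the empirical characteristic function and the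
product of its marginals. -/
lemma QHat_eq_integral : QHat K₂ h σ y N =
    (1 / 2) * ∫ t, ‖empiricalCharFun y N t - empiricalCharFunProd y N t‖ ^ 2 ∂Measure.pi ν := by
  have hint : ∀ {f g : (Fin d → ℝ) → ℂ}, Continuous f → Continuous g → (∀ t, ‖f t‖ ≤ 1) →
      (∀ t, ‖g t‖ ≤ 1) → Integrable (fun t => f t * conj (g t)) (Measure.pi ν) := by
    intro f g hf hg hf1 hg1
    refine Integrable.of_bound (hf.mul (Complex.continuous_conj.comp hg)).aestronglyMeasurable 1
      (ae_of_all _ fun t => ?_)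
    rw [norm_mul, RCLike.norm_conj]
    exact mul_le_one₀ (hf1 t) (norm_nonneg _) (hg1 t)
  have hsum : ∀ {a b c e : (Fin d → ℝ) → ℂ}, Integrable a (Measure.pi ν) →
      Integrable b (Measure.pi ν) → Integrable c (Measure.pi ν) → Integrable e (Measure.pi ν) →
      ∫ t, a t + b t - c t - e t ∂Measure.pi ν = ∫ t, a t ∂Measure.pi ν + ∫ t, b t ∂Measure.pi ν
        - ∫ t, c t ∂Measure.pi ν - ∫ t, e t ∂Measure.pi ν := by
    intro a b c e ha hb hc he
    rw [integral_sub (f := fun t => a t + b t - c t) ((ha.add hb).sub hc) he,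
      integral_sub (f := fun t => a t + b t) (ha.add hb) hc, integral_add ha hb]
  have hA := continuous_empiricalCharFun y N
  have hB := continuous_empiricalCharFunProd y N
  have hA1 := norm_empiricalCharFun_le y N
  have hB1 := norm_empiricalCharFunProd_le y N
  have hexp : ∀ t, ((‖empiricalCharFun y N t - empiricalCharFunProd y N t‖ ^ 2 : ℝ) : ℂ) =
      empiricalCharFun y N t * conj (empiricalCharFun y N t)
        + empiricalCharFunProd y N t * conj (empiricalCharFunProd y N t)
        - empiricalCharFun y N t * conj (empiricalCharFunProd y N t)
        - empiricalCharFunProd y N t * conj (empiricalCharFun y N t) := fun t => by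
    rw [Complex.ofReal_pow, ← Complex.mul_conj', map_sub]
    ring
  -- The two cross terms are conjugate and one of them is real, so they agree; hence the factor 2 in
  -- Q̂.
  have hBA : ∫ t, empiricalCharFunProd y N t * conj (empiricalCharFun y N t) ∂Measure.pi ν =
      (sampleMean y N (fun z => ∏ k, piHatMarginal K₂ h σ y N k (z k)) : ℂ) := by
    rw [← Complex.conj_ofReal, ← integral_empiricalCharFun_mul_conj_empiricalCharFunProd y N hν,
      ← integral_conj]
    simp [mul_comm]
  apply Complex.ofReal_injective
  rw [Complex.ofReal_mul, ← integral_complex_ofReal]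
  simp only [hexp]
  rw [hsum (hint hA hA hA1 hA1) (hint hB hB hB1 hB1) (hint hA hB hA1 hB1) (hint hB hA hB1 hA1), hBA,
    integral_empiricalCharFun_mul_conj_self y N hν,
    integral_empiricalCharFunProd_mul_conj_self y N hν,
    integral_empiricalCharFun_mul_conj_empiricalCharFunProd y N hν, QHat]
  push_cast
  ring

end Empirical

/-! ### Almost sure limit and its positivity -/

section Limit

variable {Ω : Type*} [MeasurableSpace Ω] {μ : Measure Ω} {d : ℕ}

/-- The difference between the joint characteristic function of a random vector and the product of
its marginal characteristic functions. -/
noncomputable def charFunDefect (μ : Measure Ω) (Y : Ω → Fin d → ℝ) (t : Fin d → ℝ) : ℂ :=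
  ∫ ω, ∏ i, planeWave (t i) (Y ω i) ∂μ - ∏ k, ∫ ω, planeWave (t k) (Y ω k) ∂μ

lemma continuous_charFunDefect [IsProbabilityMeasure μ] {Y : Ω → Fin d → ℝ} (hY : Measurable Y) :
    Continuous (charFunDefect μ Y) := by
  have hYi : ∀ i, Measurable fun ω => Y ω i := fun i => (measurable_pi_apply i).comp hY
  refine Continuous.sub ?_ (continuous_finsetProd _ fun k _ => ?_)
  · refine continuous_of_dominated (bound := fun _ => 1) (fun t => ?_)
      (fun t => ae_of_all _ fun ω => norm_prod_le_one fun i => by simp) (integrable_const _)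
      (ae_of_all _ fun ω => by fun_prop)
    exact (Finset.measurable_prod _ fun i _ =>
      measurable_const.planeWave (hYi i)).aestronglyMeasurable
  · refine continuous_of_dominated (bound := fun _ => 1) (fun t => ?_)
      (fun t => ae_of_all _ fun ω => by simp) (integrable_const _)
      (ae_of_all _ fun ω => by fun_prop)
    exact (measurable_const.planeWave (hYi k)).aestronglyMeasurable

/-- Dependent components are detected by the characteristic function. -/
lemma exists_charFunDefect_ne_zero [IsProbabilityMeasure μ] {Y : Ω → Fin d → ℝ}
    (hY : Measurable Y) (hdep : ¬ iIndepFun (fun k ω => Y ω k) μ) :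
    ∃ t, charFunDefect μ Y t ≠ 0 := by
  have hYi : ∀ i, Measurable fun ω => Y ω i := fun i => (measurable_pi_apply i).comp hY
  by_contra! hzero
  refine hdep ((iIndepFun_iff_charFun_pi fun i => (hYi i).aemeasurable).2 fun t => ?_)
  have ht := sub_eq_zero.1 (hzero fun i => t i)
  have hmeas : Measurable fun ω => WithLp.toLp 2 (Y ω ·) := by fun_prop
  rw [charFun_apply, integral_map hmeas.aemeasurable (by fun_prop)]
  convert ht using 1
  · refine integral_congr_ae (ae_of_all _ fun ω => ?_)
    simp only [planeWave, ← Complex.exp_sum, ← Finset.sum_mul, PiLp.inner_apply]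
    simp
  · refine Finset.prod_congr rfl fun k _ => ?_
    rw [charFun_apply_real, integral_map (hYi k).aemeasurable (by fun_prop)]
    simp [planeWave]

/-- The strong law of large numbers for a bounded measurable function of an i.i.d. sample. -/
lemma ae_tendsto_sum_range_div [IsProbabilityMeasure μ] {Y : Ω → Fin d → ℝ}
    {S : ℕ → Ω → Fin d → ℝ} (hS_indep : iIndepFun S μ)
    (hS_ident : ∀ n, IdentDistrib (S n) Y μ μ) {f : (Fin d → ℝ) → ℂ} (hf : Measurable f)
    (hf1 : ∀ x, ‖f x‖ ≤ 1) :
    ∀ᵐ ω ∂μ, Tendsto (fun N : ℕ => (∑ n ∈ Finset.range N, f (S n ω)) / (N : ℂ)) atTop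
      (𝓝 (∫ ω, f (Y ω) ∂μ)) := by
  have hident : ∀ n, IdentDistrib (fun ω => f (S n ω)) (fun ω => f (Y ω)) μ μ :=
    fun n => (hS_ident n).comp hf
  have := strong_law_ae (fun n ω => f (S n ω))
    (Integrable.of_bound (hident 0).aemeasurable_fst.aestronglyMeasurable 1
      (ae_of_all _ fun ω => hf1 _))
    (fun i j hij => (hS_indep.indepFun hij).comp hf hf)
    (fun n => (hident n).trans (hident 0).symm)
  filter_upwards [this] with ω hω
  rw [(hident 0).integral_eq] at hω
  refine hω.congr fun N => ?_
  rw [Complex.real_smul]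
  push_cast
  ring

lemma ae_tendsto_empiricalCharFun_sub [IsProbabilityMeasure μ] {Y : Ω → Fin d → ℝ}
    {S : ℕ → Ω → Fin d → ℝ} (hS_indep : iIndepFun S μ)
    (hS_ident : ∀ n, IdentDistrib (S n) Y μ μ) (t : Fin d → ℝ) :
    ∀ᵐ ω ∂μ, Tendsto (fun N : ℕ => empiricalCharFun (fun n => S n ω) N t
      - empiricalCharFunProd (fun n => S n ω) N t) atTop (𝓝 (charFunDefect μ Y t)) := by
  have h1 := ae_tendsto_sum_range_div hS_indep hS_ident
    (f := fun x => ∏ i, planeWave (t i) (x i)) (by fun_prop)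
    (fun x => norm_prod_le_one fun i => by simp)
  have h2 : ∀ᵐ ω ∂μ, ∀ k, Tendsto
      (fun N : ℕ => (∑ n ∈ Finset.range N, planeWave (t k) (S n ω k)) / (N : ℂ)) atTop
      (𝓝 (∫ ω, planeWave (t k) (Y ω k) ∂μ)) :=
    ae_all_iff.2 fun k => ae_tendsto_sum_range_div hS_indep hS_ident
      (f := fun x => planeWave (t k) (x k)) (by fun_prop) (fun x => by simp)
  filter_upwards [h1, h2] with ω hω1 hω2
  exact hω1.sub (tendsto_finsetProd _ fun k _ => hω2 k)

/-- Almost surely, the empirical defect converges almost everywhere in the frequency variable. -/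
lemma ae_ae_tendsto_empiricalCharFun_sub [IsProbabilityMeasure μ] {Y : Ω → Fin d → ℝ}
    (hY : Measurable Y) {S : ℕ → Ω → Fin d → ℝ} (hS : ∀ n, Measurable (S n))
    (hS_indep : iIndepFun S μ) (hS_ident : ∀ n, IdentDistrib (S n) Y μ μ)
    (ρ : Measure (Fin d → ℝ)) [SFinite ρ] :
    ∀ᵐ ω ∂μ, ∀ᵐ t ∂ρ, Tendsto (fun N : ℕ => empiricalCharFun (fun n => S n ω) N t
      - empiricalCharFunProd (fun n => S n ω) N t) atTop (𝓝 (charFunDefect μ Y t)) := by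
  -- Subtracting the defect makes the limit the constant 0, so the convergence set is jointly
  -- measurable and the two quantifiers "almost every" can be exchanged.
  have hmeas : MeasurableSet {p : (Fin d → ℝ) × Ω |
      Tendsto (fun N : ℕ => empiricalCharFun (fun n => S n p.2) N p.1
        - empiricalCharFunProd (fun n => S n p.2) N p.1 - charFunDefect μ Y p.1)
        atTop (𝓝 0)} := by
    refine measurableSet_tendsto _ fun N => ?_
    have hSm : ∀ n i, Measurable fun p : (Fin d → ℝ) × Ω => S n p.2 i := fun n i =>
      (measurable_pi_apply i).comp ((hS n).comp measurable_snd)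
    refine Measurable.sub (Measurable.sub ?_ ?_)
      ((continuous_charFunDefect hY).measurable.comp measurable_fst)
    · unfold empiricalCharFun
      fun_prop
    · unfold empiricalCharFunProd
      fun_prop
  have key := (Measure.ae_ae_comm (μ := ρ) (ν := μ) (p := fun t ω =>
    Tendsto (fun N : ℕ => empiricalCharFun (fun n => S n ω) N t
      - empiricalCharFunProd (fun n => S n ω) N t - charFunDefect μ Y t) atTop (𝓝 0)) hmeas).1
    (ae_of_all _ fun t => by
      filter_upwards [ae_tendsto_empiricalCharFun_sub hS_indep hS_ident t] with ω hω
      exact tendsto_sub_nhds_zero_iff.2 hω)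
  filter_upwards [key] with ω hω
  filter_upwards [hω] with t ht
  exact tendsto_sub_nhds_zero_iff.1 ht

/-- By continuity the defect is nonzero on a whole neighbourhood of some point, which has positive
`ρ`-measure; its modulus is at most 2, so its square is integrable. -/
lemma integral_norm_charFunDefect_sq_pos [IsProbabilityMeasure μ] {Y : Ω → Fin d → ℝ}
    (hY : Measurable Y) (hdep : ¬ iIndepFun (fun k ω => Y ω k) μ)
    (ρ : Measure (Fin d → ℝ)) [IsFiniteMeasure ρ] [ρ.IsOpenPosMeasure] :
    0 < ∫ t, ‖charFunDefect μ Y t‖ ^ 2 ∂ρ := by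
  obtain ⟨t₀, ht₀⟩ := exists_charFunDefect_ne_zero hY hdep
  have hc : Continuous fun t => ‖charFunDefect μ Y t‖ ^ 2 :=
    (continuous_charFunDefect hY).norm.pow 2
  refine integral_pos_of_integrable_nonneg_nonzero (x := t₀) hc ?_ (fun t => by positivity)
    (by positivity)
  refine Integrable.of_bound hc.aestronglyMeasurable (2 ^ 2) (ae_of_all _ fun t => ?_)
  rw [norm_pow, norm_norm]
  gcongr
  have hle : ∀ {f : Ω → ℂ}, (∀ ω, ‖f ω‖ ≤ 1) → ‖∫ ω, f ω ∂μ‖ ≤ 1 := fun hf => by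
    simpa using norm_integral_le_of_norm_le_const (μ := μ) (ae_of_all _ hf)
  refine (norm_sub_le _ _).trans ?_
  have h1 := hle (f := fun ω => ∏ i, planeWave (t i) (Y ω i))
    fun ω => norm_prod_le_one fun i => by simp
  have h2 : ‖∏ k, ∫ ω, planeWave (t k) (Y ω k) ∂μ‖ ≤ 1 :=
    norm_prod_le_one fun k => hle fun ω => by simp
  linarith

lemma tendsto_integral_norm_empiricalCharFun_sub_sq {y : ℕ → Fin d → ℝ}
    {ρ : Measure (Fin d → ℝ)} [IsFiniteMeasure ρ] {D : (Fin d → ℝ) → ℂ}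
    (hD : ∀ᵐ t ∂ρ, Tendsto (fun N : ℕ => empiricalCharFun y N t - empiricalCharFunProd y N t)
      atTop (𝓝 (D t))) :
    Tendsto (fun N : ℕ => ∫ t, ‖empiricalCharFun y N t - empiricalCharFunProd y N t‖ ^ 2 ∂ρ)
      atTop (𝓝 (∫ t, ‖D t‖ ^ 2 ∂ρ)) := by
  refine tendsto_integral_of_dominated_convergence (fun _ => 2 ^ 2) (fun N => ?_)
    (integrable_const _) (fun N => ae_of_all _ fun t => ?_) ?_
  · exact (((continuous_empiricalCharFun y N).sub
      (continuous_empiricalCharFunProd y N)).norm.pow 2).aestronglyMeasurable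
  · rw [norm_pow, norm_norm]
    gcongr
    have := norm_sub_le (empiricalCharFun y N t) (empiricalCharFunProd y N t)
    linarith [norm_empiricalCharFun_le y N t, norm_empiricalCharFunProd_le y N t]
  · filter_upwards [hD] with t ht
    exact ht.norm.pow 2

end Limit

theorem mainTheorem4
    {Ω : Type*} [MeasurableSpace Ω] (μ : Measure Ω) [IsProbabilityMeasure μ]
    (d : ℕ)
    -- the kernel, its Fourier transform, the bandwidth and the scale factors
    (K₂ ψ : ℝ → ℝ) (hK₂ : Continuous K₂)
    (hψ : IsFourierTransform K₂ ψ) (hψ_int : Integrable ψ)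
    (hψ_pos : ∀ᵐ t : ℝ, 0 < ψ t)
    (h : ℝ) (hh : 0 < h) (σ : Fin d → ℝ) (hσ : ∀ k, 0 < σ k)
    -- the random vector, with dependent components, and an i.i.d. sample of it
    (Y : Ω → Fin d → ℝ) (hY : Measurable Y)
    (hdep : ¬ iIndepFun (fun k ω => Y ω k) μ)
    (S : ℕ → Ω → Fin d → ℝ) (hS : ∀ n, Measurable (S n))
    (hS_indep : iIndepFun S μ) (hS_ident : ∀ n, IdentDistrib (S n) Y μ μ) :
    ∀ᵐ ω ∂μ, ∃ L : ℝ, 0 < L ∧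
      Tendsto (fun N : ℕ => QHat K₂ h σ (fun n => S n ω) N) atTop (𝓝 L) := by
  choose ν hfin hopen hν using fun k =>
    hψ.exists_measure_scaledKernel hK₂ hψ_int hψ_pos hh (hσ k)
  filter_upwards [ae_ae_tendsto_empiricalCharFun_sub hY hS hS_indep hS_ident (Measure.pi ν)]
    with ω hω
  refine ⟨(1 / 2) * ∫ t, ‖charFunDefect μ Y t‖ ^ 2 ∂Measure.pi ν,
    mul_pos one_half_pos (integral_norm_charFunDefect_sq_pos hY hdep _), ?_⟩
  simp only [QHat_eq_integral _ _ hν]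
  exact (tendsto_integral_norm_empiricalCharFun_sub_sq hω).const_mul _
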